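/- Let $\nu,\sigma>0$, and let $\beta_1,\gamma_1,\beta_2,\gamma_2,\dots$ be mutually independent real random variables on a probability space such that every $\beta_k$ is exponentially distributed with rate $\nu$ (mean $1/\nu$) and every $\gamma_k$ is exponentially distributed with rate $\sigma$ (mean $1/\sigma$). Consider the stochastic dynamical system $z(k)=A(k)z(k-1)$, $k\ge 1$, with $$A(k)=\begin{pmatrix}0&\beta_k\\ \gamma_k&0\end{pmatrix},\qquad z(k)=\begin{pmatrix}x(k)\\ y(k)\end{pmatrix},\qquad z(0)=\begin{pmatrix}0\\0\end{pmatrix},$$ where the matrix-vector product is taken over the semiring with maximum as addition and $+$ as multiplication, and the entries $0$ are the real number $0$; that is, $$x(k)=\max\bigl(x(k-1),\,y(k-1)+\beta_k\bigr),\qquad y(k)=\max\bigl(x(k-1)+\gamma_k,\,y(k-1)\bigr).$$ Then the Lyapunov exponent $\lambda=\lim_{k\to\infty}\frac1k\max\bigl(x(k),y(k)\bigr)$ exists almost surely and is given by $$\lambda=\frac{4\nu^2+7\nu\sigma+4\sigma^2}{6\nu\sigma(\nu+\sigma)}.$$ -/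

import Mathlib

open MeasureTheory ProbabilityTheory Filter Topology

/-- The matrix-vector product over the semiring `(ℝ, max, +)` in dimension two. -/
def maxPlusMulVec (A : Matrix (Fin 2) (Fin 2) ℝ) (z : Fin 2 → ℝ) : Fin 2 → ℝ :=
  fun i => max (z 0 + A i 0) (z 1 + A i 1)

/-- The trajectory of `z(k) = A(k) z(k-1)`, `z(0) = (0, 0)`, over the semiring `(ℝ, max, +)`.
The matrices are indexed from zero: the transition matrix of step `k + 1` is `A k`. -/
def maxPlusState (A : ℕ → Matrix (Fin 2) (Fin 2) ℝ) : ℕ → Fin 2 → ℝ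
  | 0 => ![0, 0]
  | k + 1 => maxPlusMulVec (A k) (maxPlusState A k)

/-- `l` is the Lyapunov exponent of the random max-plus system with transition matrices `A k`:
almost surely `max (x(k), y(k)) / k` tends to `l`, where `z(k) = (x(k), y(k))`. -/
def IsLyapunovExponent {Ω : Type*} [MeasurableSpace Ω] (P : Measure Ω)
    (A : ℕ → Ω → Matrix (Fin 2) (Fin 2) ℝ) (l : ℝ) : Prop :=
  ∀ᵐ ω ∂P, Tendsto
    (fun k : ℕ => (1 / (k : ℝ)) *
      max (maxPlusState (fun n => A n ω) k 0) (maxPlusState (fun n => A n ω) k 1))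
    atTop (𝓝 l)

/-! ### Integrals against the exponential distribution -/

/-! The proof solves a Poisson equation: it finds a bounded function g of d = x - y for which V =
max(x, y) + g(x - y) grows in mean by exactly l per step, from every state. For d ≥ 0, the overshoot
of β over d is, by lack of memory, zero or a fresh exponential, the latter with probability e^{-νd}.
The mean of V after one step is therefore affine in e^{-νd}, and the ansatz b(1 - e^{-νd}), with c(1
- e^{σd}) for d ≤ 0, closes up. Matching coefficients leaves three equations for b, c, l
(`integral_potential_step`). Then V(z(n)) - nl is a martingale with square-integrable increments, so
its second moment is O(n) (`exists_lintegral_sq_potential_le`). Hence V/n tends to l almost surely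
along squares; g is bounded, and monotonicity of max(x, y) fills the gaps. -/

lemma expMeasure_eq_withDensity (r : ℝ) :
    expMeasure r = (volume.restrict (Set.Ioi 0)).withDensity
      (fun x => ENNReal.ofReal (r * Real.exp (-(r * x)))) := by
  rw [expMeasure, gammaMeasure, ← withDensity_indicator measurableSet_Ioi]
  refine withDensity_congr_ae ?_
  -- The two densities may disagree at 0, a null point.
  have h0 : ∀ᵐ x : ℝ, x ≠ 0 := by simp [ae_iff]
  filter_upwards [h0] with x hx
  rcases lt_or_gt_of_ne hx with h | h
  · rw [gammaPDF_of_neg h, Set.indicator_of_notMem (by simpa using h.le)]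
  · rw [Set.indicator_of_mem (by simpa using h), gammaPDF_of_nonneg h.le]
    simp

lemma ae_pos_expMeasure (r : ℝ) : ∀ᵐ x ∂(expMeasure r), 0 < x := by
  rw [expMeasure_eq_withDensity]
  exact (withDensity_absolutelyContinuous _ _).ae_le (ae_restrict_mem measurableSet_Ioi)

lemma integral_expMeasure {r : ℝ} (hr : 0 < r) (f : ℝ → ℝ) :
    ∫ x, f x ∂(expMeasure r) = ∫ x in Set.Ioi 0, r * Real.exp (-(r * x)) * f x := by
  rw [expMeasure_eq_withDensity, integral_withDensity_eq_integral_toReal_smul (by fun_prop)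
    (by simp)]
  refine integral_congr_ae (ae_of_all _ fun x => ?_)
  simp only [smul_eq_mul]
  rw [ENNReal.toReal_ofReal (by positivity)]

lemma integrable_expMeasure_iff {r : ℝ} (hr : 0 < r) (f : ℝ → ℝ) :
    Integrable f (expMeasure r) ↔
      IntegrableOn (fun x => r * Real.exp (-(r * x)) * f x) (Set.Ioi 0) := by
  rw [expMeasure_eq_withDensity, integrable_withDensity_iff_integrable_smul' (by fun_prop)
    (by simp), IntegrableOn]
  refine integrable_congr (ae_of_all _ fun x => ?_)
  simp only [smul_eq_mul]
  rw [ENNReal.toReal_ofReal (by positivity)]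

/-- The memoryless property of the exponential distribution, in integrated form. -/
lemma integral_expMeasure_max_sub {r : ℝ} (hr : 0 < r) {F : ℝ → ℝ} (hF : F 0 = 0) {a : ℝ}
    (ha : 0 ≤ a) :
    ∫ x, F (max (x - a) 0) ∂(expMeasure r) =
      Real.exp (-(r * a)) * ∫ x, F x ∂(expMeasure r) := by
  rw [integral_expMeasure hr, integral_expMeasure hr, ← integral_const_mul,
    ← integral_indicator measurableSet_Ioi, ← integral_indicator measurableSet_Ioi,
    ← integral_add_right_eq_self _ a]
  refine integral_congr_ae (ae_of_all _ fun t => ?_)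
  simp only [Set.indicator, Set.mem_Ioi, add_sub_cancel_right]
  rcases le_or_gt t 0 with ht | ht
  · simp [max_eq_right ht, hF, not_lt.2 ht]
  · rw [if_pos (by linarith), if_pos ht, max_eq_left ht.le, mul_add, neg_add, Real.exp_add]
    ring

lemma integral_exp_neg_mul_expMeasure {r s : ℝ} (hr : 0 < r) (hs : 0 < s) :
    ∫ x, Real.exp (-(s * x)) ∂(expMeasure r) = r / (r + s) := by
  rw [integral_expMeasure hr]
  have : ∀ x : ℝ, r * Real.exp (-(r * x)) * Real.exp (-(s * x)) =
      r * Real.exp (-(r + s) * x) := fun x => by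
    rw [mul_assoc, ← Real.exp_add]; ring_nf
  simp_rw [this]
  rw [integral_const_mul, integral_exp_mul_Ioi (by linarith)]
  have : r + s ≠ 0 := by positivity
  simp only [mul_zero, Real.exp_zero]
  field_simp

lemma integral_id_expMeasure {r : ℝ} (hr : 0 < r) : ∫ x, x ∂(expMeasure r) = 1 / r := by
  rw [integral_expMeasure hr]
  have h := Real.integral_rpow_mul_exp_neg_mul_Ioi (a := 2) (by norm_num) hr
  have h2 : Real.Gamma 2 = 1 := by simp
  have : ∀ x : ℝ, r * Real.exp (-(r * x)) * x =
      r * (x ^ ((2 : ℝ) - 1) * Real.exp (-(r * x))) := fun x => by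
    rw [show (2 : ℝ) - 1 = 1 by norm_num, Real.rpow_one]; ring
  simp_rw [this]
  rw [integral_const_mul, h, h2]
  norm_num
  field_simp

lemma memLp_id_expMeasure {r : ℝ} (hr : 0 < r) : MemLp (fun x : ℝ => x) 2 (expMeasure r) := by
  rw [memLp_two_iff_integrable_sq (by fun_prop), integrable_expMeasure_iff hr]
  have h := (integrableOn_rpow_mul_exp_neg_mul_rpow (p := 1) (s := 2) (by norm_num) one_pos
    hr).const_mul r
  refine IntegrableOn.congr_fun h (fun x _ => ?_) measurableSet_Ioi
  simp only [Real.rpow_one, Real.rpow_two, neg_mul]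
  ring

lemma integrable_id_expMeasure {r : ℝ} (hr : 0 < r) :
    Integrable (fun x : ℝ => x) (expMeasure r) :=
  have := isProbabilityMeasure_expMeasure hr
  (memLp_id_expMeasure hr).integrable (by norm_num)

lemma integrable_exp_neg_mul_max {α : Type*} [MeasurableSpace α] (μ : Measure α)
    [IsFiniteMeasure μ] {s : ℝ} (hs : 0 < s) {f : α → ℝ} (hf : Measurable f) :
    Integrable (fun a => Real.exp (-(s * max (f a) 0))) μ := by
  refine Integrable.of_bound (by fun_prop) 1 (ae_of_all _ fun a => ?_)
  rw [Real.norm_eq_abs, abs_of_pos (Real.exp_pos _), Real.exp_le_one_iff]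
  have := le_max_right (f a) 0
  nlinarith

lemma integrable_exp_neg_mul_expMeasure {r s : ℝ} (hr : 0 < r) (hs : 0 < s) :
    Integrable (fun x => Real.exp (-(s * x))) (expMeasure r) := by
  have := isProbabilityMeasure_expMeasure hr
  refine (integrable_exp_neg_mul_max (expMeasure r) hs measurable_id).congr ?_
  filter_upwards [ae_pos_expMeasure r] with x hx
  simp [max_eq_left hx.le]

lemma integral_one_sub_exp_neg_mul_expMeasure {r s : ℝ} (hr : 0 < r) (hs : 0 < s) :
    ∫ x, (1 - Real.exp (-(s * x))) ∂(expMeasure r) = s / (r + s) := by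
  have := isProbabilityMeasure_expMeasure hr
  rw [integral_sub (integrable_const _) (integrable_exp_neg_mul_expMeasure hr hs),
    integral_exp_neg_mul_expMeasure hr hs]
  simp only [integral_const, probReal_univ, smul_eq_mul, mul_one]
  field_simp
  ring

/-! ### A solution of the Poisson equation -/

/-- The bounded part of the potential, as a function of the difference of the two coordinates. -/
noncomputable def corrector (ν σ b c t : ℝ) : ℝ :=
  b * (1 - Real.exp (-(ν * max t 0))) + c * (1 - Real.exp (-(σ * max (-t) 0)))

/-- The potential: the maximum of the coordinates plus a bounded function of their difference. -/
noncomputable def potential (ν σ b c x y : ℝ) : ℝ :=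
  max x y + corrector ν σ b c (x - y)

/-- This symmetry reduces the Poisson equation to the half-plane y ≤ x. -/
lemma potential_swap (ν σ b c x y : ℝ) : potential ν σ b c x y = potential σ ν c b y x := by
  simp only [potential, corrector, neg_sub, max_comm x y]
  ring

@[fun_prop]
lemma continuous_potential (ν σ b c : ℝ) :
    Continuous (fun p : ℝ × ℝ => potential ν σ b c p.1 p.2) := by
  unfold potential corrector
  fun_prop

lemma abs_corrector_le {ν σ : ℝ} (hν : 0 < ν) (hσ : 0 < σ) (b c t : ℝ) :
    |corrector ν σ b c t| ≤ |b| + |c| := by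
  have key : ∀ {s : ℝ}, 0 < s → ∀ w : ℝ, |1 - Real.exp (-(s * max w 0))| ≤ 1 := by
    intro s hs w
    have h1 := Real.exp_pos (-(s * max w 0))
    have h2 : Real.exp (-(s * max w 0)) ≤ 1 := by
      rw [Real.exp_le_one_iff]
      have := le_max_right w 0
      nlinarith
    rw [abs_le]
    constructor <;> linarith
  refine (abs_add_le _ _).trans ?_
  rw [abs_mul, abs_mul]
  exact add_le_add (mul_le_of_le_one_right (abs_nonneg _) (key hν _))
    (mul_le_of_le_one_right (abs_nonneg _) (key hσ _))

lemma integrable_max_sub_expMeasure {r : ℝ} (hr : 0 < r) (d : ℝ) :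
    Integrable (fun x => max (x - d) 0) (expMeasure r) := by
  have := isProbabilityMeasure_expMeasure hr
  exact ((integrable_id_expMeasure hr).sub (integrable_const d)).pos_part

/-- One step of the system started from `(x, y)` with `y ≤ x`: decomposition of the potential into
positive parts to which the memoryless property applies. -/
lemma potential_step_eq (ν σ b c : ℝ) {x y p q : ℝ} (hxy : y ≤ x) (hq : 0 ≤ q) :
    potential ν σ b c (max x (y + p)) (max (x + q) y) =
      x + max (p - (x - y)) 0 +
        (max (q - max (p - (x - y)) 0) 0 +
          c * (1 - Real.exp (-(σ * max (q - max (p - (x - y)) 0) 0)))) +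
        b * (1 - Real.exp (-(ν * max (p - (x - y + q)) 0))) := by
  have h1 : max x (y + p) = x + max (p - (x - y)) 0 := by
    rw [← max_add_add_left, max_comm]; congr 1 <;> ring
  have h2 : max (x + q) y = x + q := max_eq_left (by linarith)
  set h := max (p - (x - y)) 0 with hh
  have h3 : max (p - (x - y + q)) 0 = max (h - q) 0 := by
    rw [hh]
    rcases le_total (p - (x - y)) 0 with h' | h'
    · rw [max_eq_right h', max_eq_right, max_eq_right] <;> linarith
    · rw [max_eq_left h']; congr 1; ring
  have h4 : max (x + h) (x + q) = x + h + max (q - h) 0 := by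
    rw [add_assoc, max_add_add_left, ← max_add_add_left h, max_comm]; congr 2 <;> ring
  rw [h1, h2, potential, corrector, h3, h4, add_sub_add_left_eq_sub, neg_sub]
  ring

/-- With e = e^{-νd}, both sides are affine in e. The hypothesis `hb` is their equality at e = 0 (d
→ ∞) and `hl` their equality at e = 1 (d = 0). -/
lemma integral_potential_step_of_le {ν σ b c l x y : ℝ} (hν : 0 < ν) (hσ : 0 < σ)
    (hb : b - c / 2 = 1 / σ - l)
    (hl : l = 1 / ν + 1 / σ - 1 / (ν + σ) + (σ * b + ν * c) / (2 * (ν + σ))) (hxy : y ≤ x) :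
    ∫ p, potential ν σ b c (max x (y + p.1)) (max (x + p.2) y)
      ∂((expMeasure ν).prod (expMeasure σ)) = potential ν σ b c x y + l := by
  have := isProbabilityMeasure_expMeasure hν
  have := isProbabilityMeasure_expMeasure hσ
  set μ := expMeasure ν with hμ
  set η := expMeasure σ with hη
  set d := x - y with hd
  have hd0 : 0 ≤ d := by linarith
  have hpos : ∀ᵐ p ∂(μ.prod η), 0 < p.2 :=
    Measure.quasiMeasurePreserving_snd.ae (ae_pos_expMeasure σ)
  have hcongr : ∀ᵐ p ∂(μ.prod η), potential ν σ b c (max x (y + p.1)) (max (x + p.2) y) =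
      x + max (p.1 - d) 0 +
        (max (p.2 - max (p.1 - d) 0) 0 +
          c * (1 - Real.exp (-(σ * max (p.2 - max (p.1 - d) 0) 0)))) +
        b * (1 - Real.exp (-(ν * max (p.1 - (d + p.2)) 0))) := by
    filter_upwards [hpos] with p hp
    exact potential_step_eq ν σ b c hxy hp.le
  have i1 : Integrable (fun p : ℝ × ℝ => max (p.1 - d) 0) (μ.prod η) :=
    (integrable_max_sub_expMeasure hν d).comp_fst η
  have i2 : Integrable (fun p : ℝ × ℝ => max (p.2 - max (p.1 - d) 0) 0) (μ.prod η) :=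
    (((integrable_id_expMeasure hσ).comp_snd μ).sub i1).pos_part
  have i3 : Integrable (fun p : ℝ × ℝ =>
      c * (1 - Real.exp (-(σ * max (p.2 - max (p.1 - d) 0) 0)))) (μ.prod η) :=
    ((integrable_const 1).sub (integrable_exp_neg_mul_max _ hσ (by fun_prop))).const_mul c
  have i4 : Integrable (fun p : ℝ × ℝ =>
      b * (1 - Real.exp (-(ν * max (p.1 - (d + p.2)) 0)))) (μ.prod η) :=
    ((integrable_const 1).sub (integrable_exp_neg_mul_max _ hν (by fun_prop))).const_mul b
  have i23 : Integrable (fun p : ℝ × ℝ => max (p.2 - max (p.1 - d) 0) 0 +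
      c * (1 - Real.exp (-(σ * max (p.2 - max (p.1 - d) 0) 0)))) (μ.prod η) := i2.add i3
  have i01 : Integrable (fun p : ℝ × ℝ => x + max (p.1 - d) 0) (μ.prod η) :=
    (integrable_const x).add i1
  have e1 : ∫ p, max (p.1 - d) 0 ∂(μ.prod η) = Real.exp (-(ν * d)) * (1 / ν) := by
    rw [integral_fun_fst (fun z : ℝ => max (z - d) 0), probReal_univ, one_smul, hμ,
      integral_expMeasure_max_sub hν (F := fun z => z) rfl hd0, integral_id_expMeasure hν]
  have e2 : ∫ p, (max (p.2 - max (p.1 - d) 0) 0 +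
      c * (1 - Real.exp (-(σ * max (p.2 - max (p.1 - d) 0) 0)))) ∂(μ.prod η) =
      (1 - Real.exp (-(ν * d)) * (σ / (ν + σ))) * (1 / σ + c / 2) := by
    rw [integral_prod _ i23]
    have inner : ∀ p : ℝ, ∫ q, (max (q - max (p - d) 0) 0 +
        c * (1 - Real.exp (-(σ * max (q - max (p - d) 0) 0)))) ∂η =
        Real.exp (-(σ * max (p - d) 0)) * (1 / σ + c / 2) := by
      intro p
      have i : Integrable (fun z => 1 - Real.exp (-(σ * z))) (expMeasure σ) :=
        (integrable_const 1).sub (integrable_exp_neg_mul_expMeasure hσ hσ)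
      rw [hη, integral_expMeasure_max_sub hσ
        (F := fun z => z + c * (1 - Real.exp (-(σ * z)))) (by simp) (le_max_right _ _),
        integral_add (integrable_id_expMeasure hσ)
          (i.const_mul c),
        integral_id_expMeasure hσ, integral_const_mul,
        integral_one_sub_exp_neg_mul_expMeasure hσ hσ]
      congr 2
      field_simp
      ring
    simp_rw [inner]
    rw [integral_mul_const]
    congr 1
    -- The lemma needs F 0 = 0, so it is applied to 1 - e^{-σz} rather than to e^{-σz}.
    have h := integral_expMeasure_max_sub hν (F := fun z => 1 - Real.exp (-(σ * z)))
      (by simp) hd0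
    rw [integral_one_sub_exp_neg_mul_expMeasure hν hσ, integral_sub (integrable_const 1)
      (integrable_exp_neg_mul_max _ hσ (by fun_prop))] at h
    simp only [integral_const, probReal_univ, smul_eq_mul, mul_one] at h
    linarith
  have e3 : ∫ p, b * (1 - Real.exp (-(ν * max (p.1 - (d + p.2)) 0))) ∂(μ.prod η) =
      Real.exp (-(ν * d)) * (σ / (σ + ν)) * (b / 2) := by
    -- Here p is integrated first: it must overshoot d + q, a nonnegative threshold once q is
    -- frozen.
    rw [integral_prod_symm _ i4]
    have inner : ∀ᵐ q ∂η, ∫ p, b * (1 - Real.exp (-(ν * max (p - (d + q)) 0))) ∂μ =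
        Real.exp (-(ν * q)) * (Real.exp (-(ν * d)) * (b / 2)) := by
      filter_upwards [ae_pos_expMeasure σ] with q hq
      rw [hμ, integral_expMeasure_max_sub hν
        (F := fun z => b * (1 - Real.exp (-(ν * z)))) (by simp) (by linarith),
        integral_const_mul, integral_one_sub_exp_neg_mul_expMeasure hν hν, mul_add, neg_add,
        Real.exp_add]
      field_simp
      ring
    rw [integral_congr_ae inner, integral_mul_const, hη, integral_exp_neg_mul_expMeasure hσ hν]
    ring
  rw [integral_congr_ae hcongr, integral_add (f := fun p : ℝ × ℝ => x + max (p.1 - d) 0 +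
      (max (p.2 - max (p.1 - d) 0) 0 +
        c * (1 - Real.exp (-(σ * max (p.2 - max (p.1 - d) 0) 0))))) (i01.add i23) i4,
    integral_add i01 i23, integral_add (integrable_const x) i1,
    e1, e2, e3]
  have hpot : potential ν σ b c x y = x + b * (1 - Real.exp (-(ν * d))) := by
    simp [potential, corrector, ← hd, max_eq_left hd0, max_eq_right (neg_nonpos.2 hd0), hxy]
  rw [hpot]
  simp only [integral_const, probReal_univ, smul_eq_mul, one_mul]
  generalize Real.exp (-(ν * d)) = e
  have : b * (1 - e) + l = e * (1 / ν + 1 / σ - 1 / (ν + σ) +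
      (σ * b + ν * c) / (2 * (ν + σ))) + (1 - e) * (1 / σ + c / 2) := by
    rw [← hl]; linear_combination (1 - e) * hb
  rw [add_assoc x (b * _) l, this]
  field_simp
  ring

lemma integral_potential_step {ν σ b c l : ℝ} (hν : 0 < ν) (hσ : 0 < σ)
    (hb : b - c / 2 = 1 / σ - l) (hc : c - b / 2 = 1 / ν - l)
    (hl : l = 1 / ν + 1 / σ - 1 / (ν + σ) + (σ * b + ν * c) / (2 * (ν + σ))) (x y : ℝ) :
    ∫ p, potential ν σ b c (max x (y + p.1)) (max (x + p.2) y)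
      ∂((expMeasure ν).prod (expMeasure σ)) = potential ν σ b c x y + l := by
  have := isProbabilityMeasure_expMeasure hν
  have := isProbabilityMeasure_expMeasure hσ
  rcases le_total y x with h | h
  · exact integral_potential_step_of_le hν hσ hb hl h
  · rw [potential_swap, ← integral_potential_step_of_le hσ hν hc (by rw [hl]; ring) h,
      ← integral_prod_swap]
    refine integral_congr_ae (ae_of_all _ fun p => ?_)
    simp only [Prod.fst_swap, Prod.snd_swap]
    rw [potential_swap, max_comm y, max_comm x]

/-- Over one step the potential changes by at most the sum of the two noise variables, up to a
constant. -/
lemma abs_potential_step_sub_le {ν σ : ℝ} (hν : 0 < ν) (hσ : 0 < σ) (b c l x y : ℝ) {p q : ℝ}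
    (hp : 0 ≤ p) (hq : 0 ≤ q) :
    |potential ν σ b c (max x (y + p)) (max (x + q) y) - potential ν σ b c x y - l| ≤
      p + q + (2 * (|b| + |c|) + |l|) := by
  have h1 := abs_le.1 (abs_corrector_le hν hσ b c (max x (y + p) - max (x + q) y))
  have h2 := abs_le.1 (abs_corrector_le hν hσ b c (x - y))
  have h3 := le_abs_self l
  have h4 := neg_abs_le l
  have h5 : max x y ≤ max (max x (y + p)) (max (x + q) y) :=
    max_le_max (le_max_left _ _) (le_max_right _ _)
  have h6 : max (max x (y + p)) (max (x + q) y) ≤ max x y + p + q := by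
    have := le_max_left x y
    have := le_max_right x y
    refine max_le (max_le ?_ ?_) (max_le ?_ ?_) <;> linarith
  unfold potential
  rw [abs_le]
  constructor <;> linarith [h1.1, h1.2, h2.1, h2.2]

/-! ### The trajectory as a function of the noise -/

/-- The trajectory `(x(n), y(n))` driven by the noise `w`, where `w (Sum.inl k)` and
`w (Sum.inr k)` are the two noise variables of step `k + 1`. -/
def trajectory (w : ℕ ⊕ ℕ → ℝ) : ℕ → ℝ × ℝ
  | 0 => (0, 0)
  | n + 1 => (max (trajectory w n).1 ((trajectory w n).2 + w (Sum.inl n)),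
      max ((trajectory w n).1 + w (Sum.inr n)) (trajectory w n).2)

lemma maxPlusState_eq_trajectory (w : ℕ ⊕ ℕ → ℝ) (n : ℕ) :
    maxPlusState (fun k => !![0, w (Sum.inl k); w (Sum.inr k), 0]) n =
      ![(trajectory w n).1, (trajectory w n).2] := by
  induction n with
  | zero => rfl
  | succ n ih =>
    rw [maxPlusState, ih]
    ext i
    fin_cases i <;> simp [maxPlusMulVec, trajectory]

lemma monotone_max_trajectory (w : ℕ ⊕ ℕ → ℝ) :
    Monotone (fun n => max (trajectory w n).1 (trajectory w n).2) :=
  monotone_nat_of_le_succ fun _ => max_le_max (le_max_left _ _) (le_max_right _ _)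

lemma measurable_trajectory (n : ℕ) : Measurable (fun w => trajectory w n) := by
  induction n with
  | zero => exact measurable_const
  | succ n ih =>
    simp only [trajectory]
    fun_prop

lemma trajectory_congr {w w' : ℕ ⊕ ℕ → ℝ} {n : ℕ}
    (h : ∀ k < n, w (Sum.inl k) = w' (Sum.inl k) ∧ w (Sum.inr k) = w' (Sum.inr k)) :
    trajectory w n = trajectory w' n := by
  induction n with
  | zero => rfl
  | succ n ih =>
    simp only [trajectory, ih fun k hk => h k (by omega), (h n (by omega)).1, (h n (by omega)).2]

section

variable {Ω : Type*} [MeasurableSpace Ω] {P : Measure Ω}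

lemma aemeasurable_trajectory {X : ℕ ⊕ ℕ → Ω → ℝ} (hX : ∀ i, AEMeasurable (X i) P) (n : ℕ) :
    AEMeasurable (fun ω => trajectory (fun i => X i ω) n) P :=
  (measurable_trajectory n).comp_aemeasurable (aemeasurable_pi_lambda _ hX)

/-- The state at time `n` is independent of the noise of the next step. -/
lemma indepFun_trajectory_noise {X : ℕ ⊕ ℕ → Ω → ℝ} (hX : ∀ i, AEMeasurable (X i) P)
    (hindep : iIndepFun X P) (n : ℕ) :
    IndepFun (fun ω => trajectory (fun i => X i ω) n)
      (fun ω => (X (Sum.inl n) ω, X (Sum.inr n) ω)) P := by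
  classical
  let S : Finset (ℕ ⊕ ℕ) := (Finset.range n).disjSum (Finset.range n)
  let T : Finset (ℕ ⊕ ℕ) := {Sum.inl n, Sum.inr n}
  have hST : Disjoint S T := by
    rw [Finset.disjoint_left]
    rintro (i | i) hi <;> simp [S, T] at hi ⊢ <;> omega
  -- The filler 0 outside `S` is never read during the first n steps.
  let φ : (S → ℝ) → ℝ × ℝ := fun v => trajectory (fun i => if h : i ∈ S then v ⟨i, h⟩ else 0) n
  have hφ : Measurable φ := by
    refine (measurable_trajectory n).comp (measurable_pi_lambda _ fun i => ?_)
    by_cases h : i ∈ S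
    · simp only [h, dite_true]; fun_prop
    · simp only [h, dite_false]; fun_prop
  let ψ : (T → ℝ) → ℝ × ℝ := fun v =>
    (v ⟨Sum.inl n, by simp [T]⟩, v ⟨Sum.inr n, by simp [T]⟩)
  have hψ : Measurable ψ := by fun_prop
  have h := (hindep.indepFun_finset₀ S T hST hX).comp hφ hψ
  have e : (fun ω => trajectory (fun i => X i ω) n) = φ ∘ fun ω (i : S) => X i ω := by
    funext ω
    refine trajectory_congr fun k hk => ?_
    have h1 : Sum.inl k ∈ S := by simp [S, hk]
    have h2 : Sum.inr k ∈ S := by simp [S, hk]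
    simp [h1, h2]
  rw [e]
  exact h

/-- The product law lets Fubini with a frozen state replace conditional expectations. -/
lemma hasLaw_trajectory_noise [IsProbabilityMeasure P] {ν σ : ℝ} {β γ : ℕ → Ω → ℝ}
    (hβ : ∀ k, HasLaw (β k) (expMeasure ν) P) (hγ : ∀ k, HasLaw (γ k) (expMeasure σ) P)
    (hindep : iIndepFun (Sum.elim β γ) P) (n : ℕ) :
    HasLaw (fun ω => (trajectory (fun i => Sum.elim β γ i ω) n, (β n ω, γ n ω)))
      ((P.map (fun ω => trajectory (fun i => Sum.elim β γ i ω) n)).prod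
        ((expMeasure ν).prod (expMeasure σ))) P := by
  have hX : ∀ i, AEMeasurable (Sum.elim β γ i) P := by
    rintro (i | i)
    exacts [(hβ i).aemeasurable, (hγ i).aemeasurable]
  have hZ := aemeasurable_trajectory hX n
  have hβn := (hβ n).aemeasurable
  have hγn := (hγ n).aemeasurable
  have hN : AEMeasurable (fun ω => (β n ω, γ n ω)) P := hβn.prodMk hγn
  refine ⟨hZ.prodMk hN, ?_⟩
  have hi : IndepFun (β n) (γ n) P :=
    hindep.indepFun (i := Sum.inl n) (j := Sum.inr n) (by simp)
  rw [(indepFun_iff_map_prod_eq_prod_map_map hZ hN).1 (indepFun_trajectory_noise hX hindep n),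
    (indepFun_iff_map_prod_eq_prod_map_map hβn hγn).1 hi, (hβ n).map_eq, (hγ n).map_eq]

end

/-! ### Second moments -/

/-- Orthogonality of martingale increments: the cross term 2s∫q vanishes. Here s is the frozen past
and q the new increment. -/
lemma lintegral_sq_add_le {α : Type*} [MeasurableSpace α] {ρ : Measure α} [IsProbabilityMeasure ρ]
    {q B : α → ℝ} (hq : AEStronglyMeasurable q ρ) (hB : MemLp B 2 ρ) (hqB : ∀ᵐ a ∂ρ, |q a| ≤ B a)
    (hq0 : ∫ a, q a ∂ρ = 0) (s : ℝ) :
    ∫⁻ a, ENNReal.ofReal ((s + q a) ^ 2) ∂ρ ≤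
      ENNReal.ofReal (s ^ 2) + ENNReal.ofReal (∫ a, B a ^ 2 ∂ρ) := by
  have hqL : MemLp q 2 ρ := hB.of_le hq (by
    filter_upwards [hqB] with a ha
    exact ha.trans (le_abs_self _))
  have iq : Integrable q ρ := hqL.integrable (by norm_num)
  have iq2 : Integrable (fun a => q a ^ 2) ρ := hqL.integrable_sq
  have hsum : Integrable (fun a => (s + q a) ^ 2) ρ :=
    ((memLp_const s).add hqL).integrable_sq
  rw [← ofReal_integral_eq_lintegral_ofReal hsum (ae_of_all _ fun a => sq_nonneg _),
    ← ENNReal.ofReal_add (sq_nonneg _) (integral_nonneg fun a => sq_nonneg _)]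
  refine ENNReal.ofReal_le_ofReal ?_
  have e : ∫ a, (s + q a) ^ 2 ∂ρ = s ^ 2 + ∫ a, q a ^ 2 ∂ρ := by
    have i1 : Integrable (fun a => s ^ 2 + 2 * s * q a) ρ :=
      (integrable_const _).add (iq.const_mul _)
    simp_rw [add_sq]
    rw [integral_add i1 iq2, integral_add (integrable_const _) (iq.const_mul _),
      integral_const_mul, hq0]
    simp
  rw [e]
  refine add_le_add le_rfl (integral_mono_ae iq2 hB.integrable_sq ?_)
  filter_upwards [hqB] with a ha
  exact sq_le_sq' (neg_le_of_abs_le ha) (le_of_abs_le ha)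

/-- A sequence of random variables whose second moments grow at most linearly satisfies the strong
law of large numbers along the squares. -/
lemma ae_tendsto_div_sq_of_lintegral_sq_le {Ω : Type*} [MeasurableSpace Ω] {P : Measure Ω}
    {M : ℕ → Ω → ℝ} (hM : ∀ n, AEMeasurable (M n) P) {K : ℝ}
    (hK : ∀ n, ∫⁻ ω, ENNReal.ofReal (M n ω ^ 2) ∂P ≤ n * ENNReal.ofReal K) :
    ∀ᵐ ω ∂P, Tendsto (fun n : ℕ => M (n ^ 2) ω / ((n ^ 2 : ℕ) : ℝ)) atTop (𝓝 0) := by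
  have hmeas : ∀ n : ℕ, AEMeasurable
      (fun ω => ENNReal.ofReal ((M (n ^ 2) ω / ((n ^ 2 : ℕ) : ℝ)) ^ 2)) P := fun n =>
    (((hM _).div_const _).pow_const 2).ennreal_ofReal
  have hbound : ∀ n : ℕ, ∫⁻ ω, ENNReal.ofReal ((M (n ^ 2) ω / ((n ^ 2 : ℕ) : ℝ)) ^ 2) ∂P ≤
      ENNReal.ofReal (1 / (n : ℝ) ^ 2) * ENNReal.ofReal K := by
    intro n
    rcases Nat.eq_zero_or_pos n with rfl | hn
    -- At n = 0 the quotient is 0 by the convention for division by zero.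
    · simp
    have hn' : (0 : ℝ) < n := by exact_mod_cast hn
    have e : ∀ ω, ENNReal.ofReal ((M (n ^ 2) ω / ((n ^ 2 : ℕ) : ℝ)) ^ 2) =
        ENNReal.ofReal (1 / (n : ℝ) ^ 4) * ENNReal.ofReal (M (n ^ 2) ω ^ 2) := by
      intro ω
      rw [← ENNReal.ofReal_mul (by positivity)]
      congr 1
      push_cast
      field_simp
    simp_rw [e]
    rw [lintegral_const_mul' _ _ ENNReal.ofReal_ne_top]
    refine (mul_le_mul_right (hK (n ^ 2)) _).trans (le_of_eq ?_)
    rw [← mul_assoc, ← ENNReal.ofReal_natCast, ← ENNReal.ofReal_mul (by positivity)]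
    congr 2
    push_cast
    field_simp
  -- The bounds K/n² are summable, so the random series of squares is almost surely finite and its
  -- terms tend to 0.
  have hfin : ∫⁻ ω, ∑' n : ℕ, ENNReal.ofReal ((M (n ^ 2) ω / ((n ^ 2 : ℕ) : ℝ)) ^ 2) ∂P ≠ ⊤ := by
    rw [lintegral_tsum hmeas]
    refine ne_top_of_le_ne_top ?_ (ENNReal.tsum_le_tsum hbound)
    rw [ENNReal.tsum_mul_right]
    refine ENNReal.mul_ne_top ?_ ENNReal.ofReal_ne_top
    exact (Real.summable_one_div_nat_pow.2 (by norm_num)).tsum_ofReal_ne_top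
  filter_upwards [ae_lt_top' (AEMeasurable.tsum hmeas) hfin] with ω hω
  have h0 := ENNReal.tendsto_atTop_zero_of_tsum_ne_top hω.ne
  have h1 := (ENNReal.tendsto_toReal ENNReal.zero_ne_top).comp h0
  simp only [Function.comp_def, ENNReal.toReal_zero, ENNReal.toReal_ofReal (sq_nonneg _)] at h1
  have h2 := h1.sqrt
  simp only [Real.sqrt_sq_eq_abs, Real.sqrt_zero] at h2
  exact (tendsto_zero_iff_abs_tendsto_zero _).2 h2

/-- A monotone sequence that converges after division by the index along the squares does so along
all integers. -/
lemma tendsto_div_of_monotone_of_tendsto_sq {u : ℕ → ℝ} {l : ℝ} (hu : Monotone u)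
    (h : Tendsto (fun n : ℕ => u (n ^ 2) / ((n ^ 2 : ℕ) : ℝ)) atTop (𝓝 l)) :
    Tendsto (fun n : ℕ => u n / n) atTop (𝓝 l) := by
  refine tendsto_div_of_monotone_of_exists_subseq_tendsto_div u l hu fun a ha =>
    ⟨fun n => n ^ 2, ?_, tendsto_pow_atTop two_ne_zero, h⟩
  -- Ratios of consecutive squares tend to 1, so they are eventually below any a > 1.
  have hlim : Tendsto (fun n : ℕ => (1 + 1 / (n : ℝ)) ^ 2) atTop (𝓝 1) := by
    simpa using (tendsto_one_div_atTop_nhds_zero_nat (𝕜 := ℝ)).const_add 1 |>.pow 2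
  filter_upwards [hlim.eventually_lt_const ha, eventually_gt_atTop 0] with n hn hn0
  have hn' : (0 : ℝ) < n := by exact_mod_cast hn0
  have e : (((n + 1) ^ 2 : ℕ) : ℝ) = (1 + 1 / (n : ℝ)) ^ 2 * ((n ^ 2 : ℕ) : ℝ) := by
    push_cast
    field_simp
  rw [e]
  gcongr

/-- The second moment of the centred potential grows at most linearly along the trajectory. -/
lemma exists_lintegral_sq_potential_le {Ω : Type*} [MeasurableSpace Ω] {P : Measure Ω}
    [IsProbabilityMeasure P] {ν σ b c l : ℝ} (hν : 0 < ν) (hσ : 0 < σ) {β γ : ℕ → Ω → ℝ}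
    (hβ : ∀ k, HasLaw (β k) (expMeasure ν) P) (hγ : ∀ k, HasLaw (γ k) (expMeasure σ) P)
    (hindep : iIndepFun (Sum.elim β γ) P)
    (hpoisson : ∀ x y, ∫ p, potential ν σ b c (max x (y + p.1)) (max (x + p.2) y)
      ∂((expMeasure ν).prod (expMeasure σ)) = potential ν σ b c x y + l) :
    ∃ K : ℝ, ∀ n : ℕ, ∫⁻ ω, ENNReal.ofReal
      ((potential ν σ b c (trajectory (fun i => Sum.elim β γ i ω) n).1
        (trajectory (fun i => Sum.elim β γ i ω) n).2 - n * l) ^ 2) ∂P ≤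
      n * ENNReal.ofReal K := by
  have := isProbabilityMeasure_expMeasure hν
  have := isProbabilityMeasure_expMeasure hσ
  set ρ := (expMeasure ν).prod (expMeasure σ) with hρ
  let B : ℝ × ℝ → ℝ := fun p => p.1 + p.2 + (2 * (|b| + |c|) + |l|)
  have hB : MemLp B 2 ρ :=
    (((memLp_id_expMeasure hν).comp_fst (expMeasure σ)).add
      ((memLp_id_expMeasure hσ).comp_snd (expMeasure ν))).add (memLp_const _)
  have hcont := continuous_potential ν σ b c
  let q : ℝ × ℝ → ℝ × ℝ → ℝ := fun z p =>
    potential ν σ b c (max z.1 (z.2 + p.1)) (max (z.1 + p.2) z.2) - potential ν σ b c z.1 z.2 - l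
  have hq : Continuous (fun zp : (ℝ × ℝ) × (ℝ × ℝ) => q zp.1 zp.2) :=
    ((hcont.comp (g := fun p : ℝ × ℝ => potential ν σ b c p.1 p.2)
      (f := fun zp : (ℝ × ℝ) × (ℝ × ℝ) =>
        (max zp.1.1 (zp.1.2 + zp.2.1), max (zp.1.1 + zp.2.2) zp.1.2)) (by fun_prop)).sub
      (hcont.comp continuous_fst)).sub continuous_const
  have hqz : ∀ z, Continuous (q z) := fun z => hq.comp (Continuous.prodMk_right z)
  have hqB : ∀ z, ∀ᵐ p ∂ρ, |q z p| ≤ B p := fun z => by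
    have h1 : ∀ᵐ p ∂ρ, 0 < p.1 :=
      Measure.quasiMeasurePreserving_fst.ae (ae_pos_expMeasure ν)
    have h2 : ∀ᵐ p ∂ρ, 0 < p.2 :=
      Measure.quasiMeasurePreserving_snd.ae (ae_pos_expMeasure σ)
    filter_upwards [h1, h2] with p hp1 hp2
    exact abs_potential_step_sub_le hν hσ b c l z.1 z.2 hp1.le hp2.le
  have hq0 : ∀ z, ∫ p, q z p ∂ρ = 0 := fun z => by
    have iq : Integrable (q z) ρ :=
      (hB.integrable (by norm_num)).mono' (hqz z).aestronglyMeasurable (hqB z)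
    have e : ∀ p, potential ν σ b c (max z.1 (z.2 + p.1)) (max (z.1 + p.2) z.2) =
        q z p + (potential ν σ b c z.1 z.2 + l) := fun p => by simp only [q]; ring
    have h := hpoisson z.1 z.2
    simp_rw [e] at h
    rw [integral_add iq (integrable_const _)] at h
    simpa using h
  refine ⟨∫ p, B p ^ 2 ∂ρ, fun n => ?_⟩
  induction n with
  | zero => simp [trajectory, potential, corrector]
  | succ n ih =>
    have hlaw := hasLaw_trajectory_noise hβ hγ hindep n
    set Z : Ω → ℝ × ℝ := fun ω => trajectory (fun i => Sum.elim β γ i ω) n with hZ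
    have hZm : AEMeasurable Z P := hlaw.aemeasurable.fst
    have : IsProbabilityMeasure (P.map Z) := Measure.isProbabilityMeasure_map hZm
    let W : ℝ × ℝ → ℝ := fun z => potential ν σ b c z.1 z.2 - n * l
    have hW : Continuous W := hcont.sub continuous_const
    have hmeas : Measurable (fun zp : (ℝ × ℝ) × (ℝ × ℝ) =>
        ENNReal.ofReal ((W zp.1 + q zp.1 zp.2) ^ 2)) :=
      ((((hW.comp continuous_fst).add hq).pow 2).measurable).ennreal_ofReal
    calc ∫⁻ ω, ENNReal.ofReal
          ((potential ν σ b c (trajectory (fun i => Sum.elim β γ i ω) (n + 1)).1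
            (trajectory (fun i => Sum.elim β γ i ω) (n + 1)).2 - (n + 1 : ℕ) * l) ^ 2) ∂P
        = ∫⁻ ω, ENNReal.ofReal ((W (Z ω) + q (Z ω) (β n ω, γ n ω)) ^ 2) ∂P := by
          refine lintegral_congr fun ω => ?_
          congr 2
          simp only [trajectory, Sum.elim_inl, Sum.elim_inr, W, q, hZ]
          push_cast
          ring
      -- Independence of the state and the next noise enters here.
      _ = ∫⁻ z, ∫⁻ p, ENNReal.ofReal ((W z + q z p) ^ 2) ∂ρ ∂(P.map Z) := by
          rw [← lintegral_prod _ hmeas.aemeasurable]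
          exact hlaw.lintegral_comp hmeas.aemeasurable
      _ ≤ ∫⁻ z, (ENNReal.ofReal (W z ^ 2) + ENNReal.ofReal (∫ p, B p ^ 2 ∂ρ)) ∂(P.map Z) :=
          lintegral_mono fun z => lintegral_sq_add_le (hqz z).aestronglyMeasurable hB (hqB z)
            (hq0 z) (W z)
      _ = ∫⁻ ω, ENNReal.ofReal (W (Z ω) ^ 2) ∂P + ENNReal.ofReal (∫ p, B p ^ 2 ∂ρ) := by
          rw [lintegral_add_right _ measurable_const, lintegral_const, measure_univ, mul_one,
            lintegral_map' (f := fun z => ENNReal.ofReal (W z ^ 2))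
              ((hW.pow 2).measurable.ennreal_ofReal).aemeasurable hZm]
      _ ≤ (n + 1 : ℕ) * ENNReal.ofReal (∫ p, B p ^ 2 ∂ρ) := by
          push_cast
          rw [add_mul, one_mul]
          exact add_le_add_left ih _

/-! ### Conclusion: from the potential to the Lyapunov exponent. -/

theorem mainTheorem4 {Ω : Type*} [MeasurableSpace Ω] (P : Measure Ω) [IsProbabilityMeasure P]
    (ν σ : ℝ) (hν : 0 < ν) (hσ : 0 < σ)
    (β γ : ℕ → Ω → ℝ)
    (hβ : ∀ k, HasLaw (β k) (expMeasure ν) P)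
    (hγ : ∀ k, HasLaw (γ k) (expMeasure σ) P)
    (hindep : iIndepFun (Sum.elim β γ) P) :
    IsLyapunovExponent P (fun k ω => !![0, β k ω; γ k ω, 0])
      ((4 * ν ^ 2 + 7 * ν * σ + 4 * σ ^ 2) / (6 * ν * σ * (ν + σ))) := by
  set l := (4 * ν ^ 2 + 7 * ν * σ + 4 * σ ^ 2) / (6 * ν * σ * (ν + σ)) with hl
  -- b and c solve b - c/2 = 1/σ - l and c - b/2 = 1/ν - l, a system of determinant 3/4. The third
  -- equation, matching at d = 0, then holds for the stated l.
  obtain ⟨b, hb⟩ : ∃ b, b = 4 / 3 * (1 / σ - l + (1 / ν - l) / 2) := ⟨_, rfl⟩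
  obtain ⟨c, hc⟩ : ∃ c, c = 4 / 3 * (1 / ν - l + (1 / σ - l) / 2) := ⟨_, rfl⟩
  have hpoisson := integral_potential_step (b := b) (c := c) (l := l) hν hσ
    (by rw [hb, hc]; ring) (by rw [hb, hc]; ring) (by rw [hb, hc, hl]; field_simp; ring)
  obtain ⟨K, hK⟩ := exists_lintegral_sq_potential_le hν hσ hβ hγ hindep hpoisson
  have hX : ∀ i, AEMeasurable (Sum.elim β γ i) P := by
    rintro (i | i)
    exacts [(hβ i).aemeasurable, (hγ i).aemeasurable]
  have hM := ae_tendsto_div_sq_of_lintegral_sq_le (fun n =>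
    ((continuous_potential ν σ b c).measurable.comp_aemeasurable
      (aemeasurable_trajectory hX n)).sub_const (n * l)) hK
  filter_upwards [hM] with ω hω
  set w : ℕ ⊕ ℕ → ℝ := fun i => Sum.elim β γ i ω with hw
  have hstate : ∀ n, maxPlusState (fun k => !![0, β k ω; γ k ω, 0]) n =
      ![(trajectory w n).1, (trajectory w n).2] := maxPlusState_eq_trajectory w
  simp only [hstate, Matrix.cons_val_zero, Matrix.cons_val_one, one_div_mul_eq_div]
  refine tendsto_div_of_monotone_of_tendsto_sq (monotone_max_trajectory w) ?_
  have hsq : Tendsto (fun n : ℕ => ((n ^ 2 : ℕ) : ℝ)) atTop atTop :=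
    tendsto_natCast_atTop_atTop.comp (tendsto_pow_atTop two_ne_zero)
  have hcorr : Tendsto (fun n : ℕ => corrector ν σ b c
      ((trajectory w (n ^ 2)).1 - (trajectory w (n ^ 2)).2) / ((n ^ 2 : ℕ) : ℝ)) atTop (𝓝 0) := by
    refine squeeze_zero_norm (fun n => ?_) (tendsto_const_nhds (x := |b| + |c|).div_atTop hsq)
    rw [norm_div, Real.norm_eq_abs, Real.norm_natCast]
    gcongr
    exact abs_corrector_le hν hσ b c _
  have hlim := (hω.sub hcorr).add_const l
  rw [sub_zero, zero_add] at hlim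
  refine hlim.congr' ?_
  filter_upwards [eventually_gt_atTop 0] with n hn
  have hn' : (((n ^ 2 : ℕ) : ℝ)) ≠ 0 := by positivity
  simp only [Function.comp_apply, potential]
  field_simp
  ring
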